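/- Let $I$ be a compact Hausdorff space with its Borel $\sigma$-algebra and a Borel probability measure $m$; write $|Q|=m(Q)$ and let $|\cdot|_p$ be the norm of $L^p=L^p(I,m)$ (complex-valued functions, identified when equal a.e.). A *good grid* is a sequence $\mathcal P=(\mathcal P^k)_{k\ge 0}$ of finite families of measurable sets of positive measure such that each $\mathcal P^k$ is a partition of $I$ up to null sets, every $Q\in\mathcal P^{k+1}$ is contained in some $R\in\mathcal P^{k}$, $\bigcup_k\mathcal P^k$ generates the $\sigma$-algebra, and there are $\hat\lambda,\lambda\in(0,1)$ with $\hat\lambda\le |Q|/|R|\le\lambda$ whenever $Q\subset R$, $Q\in\mathcal P^{k+1}$, $R\in\mathcal P^k$, $k\ge0$. A *recalibration* of a good grid $\mathcal P$ is a good grid $\mathcal G$ with $\bigcup_k\mathcal G^k\subset\bigcup_k\mathcal P^k$ such that, with $\ell_k=\max_{Q\in\mathcal G^k}|Q|$ and $m_k=\min_{Q\in\mathcal G^k}|Q|$, one has $\ell_{k+1}<\ell_k$ for all $k$ and there are $c_1,c_2,\delta\in(0,1)$ with $c_1\le \ell_{k+1}/\ell_k\le c_2$ and $1\le \ell_k/m_k\le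 1/\delta$ for all $k$. Let $p\in[1,\infty)$, $q\in[1,\infty]$, $0<s<1/p$, and let $\mathcal G$ be a recalibration of a good grid $\mathcal P$ on $I$. (For $q=\infty$ the $\ell^q$ sums over $k$ below are replaced by suprema.) * For $f\in L^1$ let $f_k=\frac1{|Q|}\int_Q f\,dm$ on each $Q\in\mathcal G^k$ ($k\ge0$), $f_{-1}=0$ and $d_kf=f_k-f_{k-1}$. The Gu--Taibleson space $B_{GT}(s,p,q)$ is the set of $f\in L^1$ with $$|f|_{B_{GT}(s,p,q)}=\Big(\sum_{k\ge0}\big(\ell_k^{-s}|d_kf|_p\big)^q\Big)^{1/q}<\infty .$$ * For $Q\in\mathcal G^k$ let $a_Q=|Q|^{s-1/p}1_Q$. The space $\mathcal B^s_{p,q}(\mathcal G)$ is the set of $f\in L^p$ that can be written as $f=\sum_{k\ge0}\sum_{Q\in\mathcal G^k}s_Qa_Q$ with $s_Q\in\mathbb C$, the series of layers $\sum_{Q\in\mathcal G^k}s_Qa_Q$ converging absolutely in $L^p$ to $f$, and $$\Big(\sum_{k\ge0}\big(\sum_{Q\in\mathcal G^k}|s_Q|^p\big)^{q/p}\Big)^{1/q}<\infty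 ;$$ the norm $|f|_{\mathcal B^s_{p,q}(\mathcal G)}$ is the infimum of these quantities over all such representations of $f$. **Proposition.** $B_{GT}(s,p,q)=\mathcal B^s_{p,q}(\mathcal G)$, and the norms are equivalent: there are constants $A,B>0$, not depending on $f$, such that for every $f$ in this space $$|f|_{\mathcal B^s_{p,q}(\mathcal G)}\le A\,|f|_{B_{GT}(s,p,q)}\quad\text{and}\quad |f|_{B_{GT}(s,p,q)}\le B\,|f|_{\mathcal B^s_{p,q}(\mathcal G)} .$$ -/

import Mathlib

open MeasureTheory Filter Topology
open scoped ENNReal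

noncomputable section

namespace GridBesov

variable {I : Type*} [MeasurableSpace I]

/-- `P` is a good grid on `(I, m)`: a nested sequence of finite partitions of `I` (up to null sets)
by measurable sets of positive measure, which generates the `σ`-algebra and for which the measures
of consecutive nested elements are uniformly comparable, with ratio bounded away from `0` and `1`. -/
structure IsGoodGrid (m : Measure I) (P : ℕ → Finset (Set I)) : Prop where
  measurableSet : ∀ k, ∀ Q ∈ P k, MeasurableSet Q
  measure_pos : ∀ k, ∀ Q ∈ P k, 0 < m Q
  aedisjoint : ∀ k, ∀ Q ∈ P k, ∀ Q' ∈ P k, Q ≠ Q' → m (Q ∩ Q') = 0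
  cover : ∀ k, m ((⋃ Q ∈ P k, Q)ᶜ) = 0
  nested : ∀ k, ∀ Q ∈ P (k + 1), ∃ R ∈ P k, Q ⊆ R
  generates : ‹MeasurableSpace I› = MeasurableSpace.generateFrom {Q | ∃ k, Q ∈ P k}
  ratio : ∃ a b : ℝ, 0 < a ∧ a < 1 ∧ 0 < b ∧ b < 1 ∧
    ∀ k, ∀ Q ∈ P (k + 1), ∀ R ∈ P k, Q ⊆ R → a ≤ m.real Q / m.real R ∧ m.real Q / m.real R ≤ b

/-- `ℓ_k`, the largest measure of an element of the `k`-th partition. -/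
def maxMeas (m : Measure I) (G : ℕ → Finset (Set I)) (k : ℕ) : ℝ :=
  ((G k).sup fun Q => m Q).toReal

/-- `m_k`, the smallest measure of an element of the `k`-th partition. -/
def minMeas (m : Measure I) (G : ℕ → Finset (Set I)) (k : ℕ) : ℝ :=
  ((G k).inf fun Q => m Q).toReal

/-- `G` is a recalibration of the good grid `P`. -/
structure IsRecalibration (m : Measure I) (P G : ℕ → Finset (Set I)) : Prop where
  isGoodGrid : IsGoodGrid m G
  subset : ∀ k, ∀ Q ∈ G k, ∃ j, Q ∈ P j
  strictAnti : ∀ k, maxMeas m G (k + 1) < maxMeas m G k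
  decay : ∃ c₁ c₂ : ℝ, 0 < c₁ ∧ c₁ < 1 ∧ 0 < c₂ ∧ c₂ < 1 ∧
    ∀ k, c₁ ≤ maxMeas m G (k + 1) / maxMeas m G k ∧ maxMeas m G (k + 1) / maxMeas m G k ≤ c₂
  balanced : ∃ δ : ℝ, 0 < δ ∧ δ < 1 ∧
    ∀ k, 1 ≤ maxMeas m G k / minMeas m G k ∧ maxMeas m G k / minMeas m G k ≤ 1 / δ

/-- The `ℓ^q` norm of a sequence in `[0, ∞]`, `q ∈ [1, ∞]` (the supremum if `q = ∞`). -/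
def lqNorm (q : ℝ≥0∞) (a : ℕ → ℝ≥0∞) : ℝ≥0∞ :=
  if q = ∞ then ⨆ k, a k else (∑' k, a k ^ q.toReal) ^ (1 / q.toReal)

/-- Souza's canonical `(s, p)`-atom on `Q`: the function `|Q|^(s - 1/p) 1_Q`. -/
def souzaAtom (m : Measure I) (s p : ℝ) (Q : Set I) : I → ℂ :=
  Q.indicator fun _ => ((m.real Q ^ (s - 1 / p) : ℝ) : ℂ)

/-- The `k`-th layer `∑_{Q ∈ G^k} c_Q a_Q` of the series with coefficients `c`. -/
def layer (m : Measure I) (G : ℕ → Finset (Set I)) (s p : ℝ) (c : ℕ → Set I → ℂ) (k : ℕ) :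
    I → ℂ :=
  fun x => ∑ Q ∈ G k, c k Q * souzaAtom m s p Q x

/-- `(∑_k (∑_{Q ∈ G^k} |c_Q|^p)^(q/p))^(1/q)`, as an element of `[0, ∞]`. -/
def coeffNorm (G : ℕ → Finset (Set I)) (p : ℝ) (q : ℝ≥0∞) (c : ℕ → Set I → ℂ) : ℝ≥0∞ :=
  lqNorm q fun k => (∑ Q ∈ G k, ‖c k Q‖ₑ ^ p) ^ (1 / p)

/-- `f` is the sum in `L^p` of the series `∑_k ∑_{Q ∈ G^k} c_Q a_Q`, which converges absolutely in
`L^p` (the `L^p` norms of the layers are summable), and the coefficient norm is finite. -/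
structure IsRepresentation (m : Measure I) (G : ℕ → Finset (Set I)) (s p : ℝ) (q : ℝ≥0∞)
    (f : I → ℂ) (c : ℕ → Set I → ℂ) : Prop where
  absConv : ∑' k, eLpNorm (layer m G s p c k) (ENNReal.ofReal p) m < ∞
  tendsto : Tendsto
    (fun n => eLpNorm (fun x => f x - ∑ k ∈ Finset.range n, layer m G s p c k x)
      (ENNReal.ofReal p) m) atTop (𝓝 0)
  coeffNorm_lt_top : coeffNorm G p q c < ∞

/-- The space `𝓑^s_{p,q}(G)` (functions are not identified when they agree a.e.; membership is
invariant under changes on null sets). -/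
def souzaBesov (m : Measure I) (G : ℕ → Finset (Set I)) (s p : ℝ) (q : ℝ≥0∞) : Set (I → ℂ) :=
  {f | MemLp f (ENNReal.ofReal p) m ∧ ∃ c, IsRepresentation m G s p q f c}

/-- The norm of `𝓑^s_{p,q}(G)`: infimum of the coefficient norm over all representations. -/
def souzaNorm (m : Measure I) (G : ℕ → Finset (Set I)) (s p : ℝ) (q : ℝ≥0∞) (f : I → ℂ) : ℝ≥0∞ :=
  ⨅ (c : ℕ → Set I → ℂ) (_ : IsRepresentation m G s p q f c), coeffNorm G p q c

/-- `f_k`: on each `Q ∈ G^k` (up to a null set) it is the mean of `f` over `Q`. -/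
def condMean (m : Measure I) (G : ℕ → Finset (Set I)) (f : I → ℂ) (k : ℕ) : I → ℂ :=
  fun x => ∑ Q ∈ G k, Q.indicator (fun _ => ⨍ y in Q, f y ∂m) x

/-- The martingale differences `d_k f = f_k - f_{k-1}`, where `f_{-1} = 0`. -/
def mdiff (m : Measure I) (G : ℕ → Finset (Set I)) (f : I → ℂ) : ℕ → I → ℂ
  | 0 => condMean m G f 0
  | k + 1 => fun x => condMean m G f (k + 1) x - condMean m G f k x

/-- `|f|_{B_GT(s,p,q)} = (∑_k (ℓ_k^{-s} |d_k f|_p)^q)^(1/q)`. -/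
def gtNorm (m : Measure I) (G : ℕ → Finset (Set I)) (s p : ℝ) (q : ℝ≥0∞) (f : I → ℂ) : ℝ≥0∞ :=
  lqNorm q fun k =>
    ENNReal.ofReal (maxMeas m G k ^ (-s)) * eLpNorm (mdiff m G f k) (ENNReal.ofReal p) m

/-- The Gu-Taibleson recalibrated martingale Besov space: the integrable functions with finite
Gu-Taibleson norm. -/
def gtBesov (m : Measure I) (G : ℕ → Finset (Set I)) (s p : ℝ) (q : ℝ≥0∞) : Set (I → ℂ) :=
  {f | Integrable f m ∧ gtNorm m G s p q f < ∞}

end GridBesov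

end

/-! The means `f_k` form the martingale of `f` along the filtration of the grid, and `d_k f` is
constant on the cells of `G k`, hence is itself a layer of atoms. The layer has `L^p` norm equal to
the `ℓ^p` norm of `|c_Q| |Q|^s`; since the cells of one level have comparable measures, `|Q|^s` may
be replaced by `ℓ_k^s` up to a constant.

From Gu-Taibleson to atoms: the representation is `f = ∑ d_k f` (`isRepresentation_mdiffCoeff`). Its
sum is identified by martingale convergence and Fatou, and it converges absolutely because `ℓ_k^s`
decays geometrically.

From atoms to Gu-Taibleson: if `f = ∑ g_k` with layers `g_k`, then `d_j g_k = 0` for `k < j`, while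
`|d_j g_k|_p ≤ 2 |g_k|_p` by contractivity of conditional expectation. So `ℓ_j^{-s} |d_j f|_p` is at
most a geometrically weighted sum of the coefficient norms at levels `j + i`, and Minkowski in `ℓ^q`
finishes (`exists_gtNorm_le`). -/

namespace GridBesov

/-! ### Sequence norms: Minkowski, shifts and Fatou in `ℓ^q`. -/

theorem lqNorm_mono {q : ℝ≥0∞} {a b : ℕ → ℝ≥0∞} (h : ∀ k, a k ≤ b k) :
    lqNorm q a ≤ lqNorm q b := by
  unfold lqNorm
  split_ifs
  · exact iSup_mono h
  · gcongr with k
    exact h k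

theorem le_lqNorm {q : ℝ≥0∞} (hq : q ≠ 0) (a : ℕ → ℝ≥0∞) (k : ℕ) : a k ≤ lqNorm q a := by
  unfold lqNorm
  split_ifs with h
  · exact le_iSup a k
  · rw [one_div, ENNReal.le_rpow_inv_iff (ENNReal.toReal_pos hq h)]
    exact ENNReal.le_tsum (f := fun k => a k ^ q.toReal) k

theorem lqNorm_const_mul {q : ℝ≥0∞} (hq : q ≠ 0) (c : ℝ≥0∞) (a : ℕ → ℝ≥0∞) :
    lqNorm q (fun k => c * a k) = c * lqNorm q a := by
  unfold lqNorm
  split_ifs with h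
  · rw [ENNReal.mul_iSup]
  · have h0 := ENNReal.toReal_pos hq h
    simp_rw [ENNReal.mul_rpow_of_nonneg _ _ h0.le]
    rw [ENNReal.tsum_mul_left, ENNReal.mul_rpow_of_nonneg _ _ (by positivity), one_div,
      ENNReal.rpow_rpow_inv h0.ne']

theorem lqNorm_add_le {q : ℝ≥0∞} (hq : 1 ≤ q) (a b : ℕ → ℝ≥0∞) :
    lqNorm q (fun k => a k + b k) ≤ lqNorm q a + lqNorm q b := by
  unfold lqNorm
  split_ifs with h
  · exact iSup_le fun k => add_le_add (le_iSup a k) (le_iSup b k)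
  · simp_rw [← lintegral_count]
    exact ENNReal.lintegral_Lp_add_le (f := a) (g := b) (by fun_prop) (by fun_prop)
      (by simpa using ENNReal.toReal_mono h hq)

theorem lqNorm_shift_le (q : ℝ≥0∞) (a : ℕ → ℝ≥0∞) (i : ℕ) :
    lqNorm q (fun k => a (k + i)) ≤ lqNorm q a := by
  unfold lqNorm
  split_ifs
  · exact iSup_le fun k => le_iSup a (k + i)
  · refine ENNReal.rpow_le_rpow ?_ (by positivity)
    exact ENNReal.tsum_comp_le_tsum_of_injective (add_left_injective i) fun k => a k ^ q.toReal

theorem lqNorm_zero {q : ℝ≥0∞} (hq : q ≠ 0) : lqNorm q (fun _ => 0) = 0 := by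
  unfold lqNorm
  split_ifs with h
  · simp
  · have h0 := ENNReal.toReal_pos hq h
    simp [h0]

theorem lqNorm_sum_le {q : ℝ≥0∞} (hq : 1 ≤ q) (a : ℕ → ℕ → ℝ≥0∞) (n : ℕ) :
    lqNorm q (fun k => ∑ i ∈ Finset.range n, a i k) ≤ ∑ i ∈ Finset.range n, lqNorm q (a i) := by
  induction n with
  | zero => simp [lqNorm_zero (zero_lt_one.trans_le hq).ne']
  | succ n ih =>
    simp_rw [Finset.sum_range_succ]
    exact (lqNorm_add_le hq _ _).trans (add_le_add ih le_rfl)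

/-- A Fatou property: for finite `q` it suffices to test finite partial sums, which pass to the
limit. It carries Minkowski from finite to countable sums. -/
theorem lqNorm_le_of_tendsto {q : ℝ≥0∞} (hq : q ≠ 0) {u : ℕ → ℕ → ℝ≥0∞} {a : ℕ → ℝ≥0∞}
    {M : ℝ≥0∞} (hu : ∀ k, Tendsto (fun n => u n k) atTop (𝓝 (a k)))
    (hM : ∀ n, lqNorm q (u n) ≤ M) : lqNorm q a ≤ M := by
  unfold lqNorm at *
  split_ifs at * with h
  · exact iSup_le fun k => le_of_tendsto' (hu k) fun n => (le_iSup (u n) k).trans (hM n)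
  · have h0 := ENNReal.toReal_pos hq h
    simp_rw [one_div, ENNReal.rpow_inv_le_iff h0] at hM ⊢
    refine ENNReal.summable.tsum_le_of_sum_le fun t => ?_
    refine le_of_tendsto' (tendsto_finsetSum t fun k _ =>
      (ENNReal.continuous_rpow_const.tendsto _).comp (hu k)) fun n => ?_
    exact (ENNReal.sum_le_tsum t).trans (hM n)

theorem lqNorm_tsum_le {q : ℝ≥0∞} (hq : 1 ≤ q) (a : ℕ → ℕ → ℝ≥0∞) :
    lqNorm q (fun k => ∑' i, a i k) ≤ ∑' i, lqNorm q (a i) :=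
  lqNorm_le_of_tendsto (zero_lt_one.trans_le hq).ne'
    (fun _ => ENNReal.tendsto_nat_tsum _) fun n =>
      (lqNorm_sum_le hq a n).trans (ENNReal.sum_le_tsum _)

theorem sum_indicator_eq_of_unique {I E : Type*} [AddCommMonoid E] {F : Finset (Set I)} {x : I}
    {Q : Set I} (hQ : Q ∈ F) (hxQ : x ∈ Q) (hu : ∀ Q' ∈ F, x ∈ Q' → Q' = Q)
    (a : Set I → I → E) : ∑ R ∈ F, R.indicator (a R) x = a Q x := by
  rw [Finset.sum_eq_single_of_mem Q hQ, Set.indicator_of_mem hxQ]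
  intro R hR hne
  exact Set.indicator_of_notMem (fun hx => hne (hu R hR hx)) _

/-! ### The filtration of a grid; cell means as conditional expectations. -/

section

variable {I : Type*} [MeasurableSpace I] {m : Measure I} {G : ℕ → Finset (Set I)}

theorem IsGoodGrid.ae_exists_unique (hG : IsGoodGrid m G) (k : ℕ) :
    ∀ᵐ x ∂m, ∃ Q ∈ G k, x ∈ Q ∧ ∀ Q' ∈ G k, x ∈ Q' → Q' = Q := by
  have h1 : ∀ᵐ x ∂m, x ∈ ⋃ Q ∈ G k, Q := hG.cover k
  have h2 : ∀ᵐ x ∂m, ∀ Q ∈ G k, ∀ Q' ∈ G k, Q ≠ Q' → x ∉ Q ∩ Q' := by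
    refine (ae_ball_iff (G k).countable_toSet).2 ?_
    intro Q hQ
    refine (ae_ball_iff (G k).countable_toSet).2 ?_
    intro Q' hQ'
    rw [ae_all_iff]
    intro h
    exact measure_eq_zero_iff_ae_notMem.1 (hG.aedisjoint k Q hQ Q' hQ' h)
  filter_upwards [h1, h2] with x hx1 hx2
  simp only [Set.mem_iUnion, exists_prop] at hx1
  obtain ⟨Q, hQ, hxQ⟩ := hx1
  refine ⟨Q, hQ, hxQ, fun Q' hQ' hx' => ?_⟩
  by_contra hne
  exact hx2 Q' hQ' Q hQ hne ⟨hx', hxQ⟩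

/-- Almost every point lies in exactly one cell, so the `p`-th power moves inside the sum. -/
theorem IsGoodGrid.eLpNorm_step (hG : IsGoodGrid m G) (k : ℕ) {p : ℝ} (hp : 0 < p)
    (a : Set I → ℂ) :
    eLpNorm (fun x => ∑ Q ∈ G k, Q.indicator (fun _ => a Q) x) (ENNReal.ofReal p) m
      = (∑ Q ∈ G k, ‖a Q‖ₑ ^ p * m Q) ^ (1 / p) := by
  rw [eLpNorm_eq_lintegral_rpow_enorm_toReal (by simpa using hp) ENNReal.ofReal_ne_top,
    ENNReal.toReal_ofReal hp.le]
  congr 1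
  have : (fun x => ‖∑ Q ∈ G k, Q.indicator (fun _ => a Q) x‖ₑ ^ p) =ᵐ[m]
      fun x => ∑ Q ∈ G k, Q.indicator (fun _ => ‖a Q‖ₑ ^ p) x := by
    filter_upwards [hG.ae_exists_unique k] with x ⟨Q, hQ, hxQ, hu⟩
    rw [sum_indicator_eq_of_unique hQ hxQ hu (fun Q _ => a Q),
      sum_indicator_eq_of_unique hQ hxQ hu (fun Q _ => ‖a Q‖ₑ ^ p)]
  rw [lintegral_congr_ae this, lintegral_finsetSum']
  · refine Finset.sum_congr rfl fun Q hQ => ?_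
    rw [lintegral_indicator (hG.measurableSet k Q hQ), setLIntegral_const]
  · intro Q hQ
    exact (measurable_const.indicator (hG.measurableSet k Q hQ)).aemeasurable

/-- The filtration generated by the first `k` partitions of a good grid. -/
def IsGoodGrid.filtration (hG : IsGoodGrid m G) : Filtration ℕ ‹MeasurableSpace I› where
  -- All levels up to `k` are needed for monotonicity: a coarse cell is a union of finer ones only
  -- up to null sets.
  seq k := MeasurableSpace.generateFrom {Q | ∃ j ≤ k, Q ∈ G j}
  mono' _ _ hkl := MeasurableSpace.generateFrom_mono fun _ ⟨j, hj, hQ⟩ => ⟨j, hj.trans hkl, hQ⟩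
  le' _ := MeasurableSpace.generateFrom_le fun _ ⟨j, _, hQ⟩ => hG.measurableSet j _ hQ

theorem IsGoodGrid.measurableSet_filtration (hG : IsGoodGrid m G) {k : ℕ} {Q : Set I}
    (hQ : Q ∈ G k) : MeasurableSet[hG.filtration k] Q :=
  MeasurableSpace.measurableSet_generateFrom ⟨k, le_rfl, hQ⟩

theorem IsGoodGrid.iSup_filtration (hG : IsGoodGrid m G) :
    ⨆ k, hG.filtration k = ‹MeasurableSpace I› := by
  refine le_antisymm (iSup_le hG.filtration.le) ?_
  conv_lhs => rw [hG.generates]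
  refine MeasurableSpace.generateFrom_le fun Q ⟨k, hQ⟩ => ?_
  exact le_iSup (fun k => hG.filtration k) k _ (hG.measurableSet_filtration hQ)

theorem IsGoodGrid.stronglyMeasurable_step (hG : IsGoodGrid m G) (k : ℕ) (a : Set I → ℂ) :
    StronglyMeasurable[hG.filtration k] (fun x => ∑ Q ∈ G k, Q.indicator (fun _ => a Q) x) := by
  refine Finset.stronglyMeasurable_fun_sum _ fun Q hQ => ?_
  exact stronglyMeasurable_const.indicator (hG.measurableSet_filtration hQ)

theorem IsGoodGrid.exists_superset (hG : IsGoodGrid m G) {j k : ℕ} (hjk : j ≤ k) :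
    ∀ Q ∈ G k, ∃ R ∈ G j, Q ⊆ R := by
  induction k, hjk using Nat.le_induction with
  | base => exact fun Q hQ => ⟨Q, hQ, subset_rfl⟩
  | succ k _ ih =>
    intro Q hQ
    obtain ⟨R, hR, hQR⟩ := hG.nested k Q hQ
    obtain ⟨S, hS, hRS⟩ := ih R hR
    exact ⟨S, hS, hQR.trans hRS⟩

/-- Cells of level `k` are atoms modulo null sets. The dichotomy is stable under complements and
countable unions, so generators suffice: `Q` sits in one cell of each coarser level and meets the
others in null sets. -/
theorem IsGoodGrid.inter_null_or_diff_null (hG : IsGoodGrid m G) {k : ℕ} {Q s : Set I}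
    (hQ : Q ∈ G k) (hs : MeasurableSet[hG.filtration k] s) : m (Q ∩ s) = 0 ∨ m (Q \ s) = 0 := by
  induction s, hs using MeasurableSpace.generateFrom_induction with
  | hC t ht _ =>
    obtain ⟨j, hj, hR⟩ := ht
    obtain ⟨S, hS, hQS⟩ := hG.exists_superset hj Q hQ
    by_cases h : S = t
    · right
      rw [← h, Set.sdiff_eq_empty.2 hQS, measure_empty]
    · left
      exact measure_mono_null (Set.inter_subset_inter_left _ hQS) (hG.aedisjoint j S hS t hR h)
  | empty => simp
  | compl t _ ih => simpa [Set.sdiff_eq, or_comm] using ih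
  | iUnion s _ ih =>
    by_cases h : ∃ n, m (Q \ s n) = 0
    · obtain ⟨n, hn⟩ := h
      right
      exact measure_mono_null (Set.sdiff_subset_sdiff_right (Set.subset_iUnion s n)) hn
    · left
      push Not at h
      rw [Set.inter_iUnion, measure_iUnion_null_iff]
      exact fun n => (ih n).resolve_right (h n)

theorem IsGoodGrid.ae_eq_sum_indicator (hG : IsGoodGrid m G) (k : ℕ) (f : I → ℂ) :
    f =ᵐ[m] fun x => ∑ Q ∈ G k, Q.indicator f x := by
  filter_upwards [hG.ae_exists_unique k] with x ⟨Q, hQ, hxQ, hu⟩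
  rw [sum_indicator_eq_of_unique hQ hxQ hu (fun _ => f)]

variable [IsProbabilityMeasure m]

/-- By the atom dichotomy, a set of the filtration meets each cell either negligibly or in almost
all of it; in the second case the integrals of `f` and of its mean agree. -/
theorem IsGoodGrid.condMean_ae_eq_condExp (hG : IsGoodGrid m G) {f : I → ℂ}
    (hf : Integrable f m) (k : ℕ) : condMean m G f k =ᵐ[m] m[f | hG.filtration k] := by
  have hint : ∀ Q ∈ G k, Integrable (Q.indicator fun _ => ⨍ y in Q, f y ∂m) m := fun Q hQ =>
    (integrable_const _).indicator (hG.measurableSet k Q hQ)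
  refine ae_eq_condExp_of_forall_setIntegral_eq (hG.filtration.le k) hf ?_ ?_
    (hG.stronglyMeasurable_step k _).aestronglyMeasurable
  · intro s _ _
    exact (integrable_finsetSum _ hint).integrableOn
  · intro s hs _
    rw [integral_congr_ae (ae_restrict_of_ae (hG.ae_eq_sum_indicator k f))]
    unfold condMean
    rw [integral_finsetSum _ fun Q hQ => (hint Q hQ).integrableOn,
      integral_finsetSum _ fun Q hQ => (hf.indicator (hG.measurableSet k Q hQ)).integrableOn]
    refine Finset.sum_congr rfl fun Q hQ => ?_
    rw [setIntegral_indicator (hG.measurableSet k Q hQ),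
      setIntegral_indicator (hG.measurableSet k Q hQ)]
    rcases hG.inter_null_or_diff_null hQ hs with h | h
    · rw [Set.inter_comm, Measure.restrict_eq_zero.2 h]
      simp
    · have hae : (s ∩ Q : Set I) =ᵐ[m] Q := by
        refine Set.inter_subset_right.eventuallyLE.antisymm ?_
        rw [ae_le_set]
        simpa [Set.sdiff_inter] using h
      rw [setIntegral_congr_set hae, setIntegral_congr_set hae]
      exact setIntegral_setAverage m f Q

end

/-! ### Martingale differences: convergence, `L^p` bounds and vanishing. -/

section

variable {I : Type*} [MeasurableSpace I] {m : Measure I} {G : ℕ → Finset (Set I)}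

theorem sum_mdiff (m : Measure I) (G : ℕ → Finset (Set I)) (f : I → ℂ) (n : ℕ) (x : I) :
    ∑ k ∈ Finset.range (n + 1), mdiff m G f k x = condMean m G f n x := by
  induction n with
  | zero => simp [mdiff]
  | succ n ih =>
    rw [Finset.sum_range_succ, ih]
    simp [mdiff]

/-- Fatou for the `L^p` norm, applied to the partial sums of the tail. -/
theorem eLpNorm_sub_sum_le_tsum {p : ℝ≥0∞} (hp : 1 ≤ p) {u : ℕ → I → ℂ} {f : I → ℂ}
    (hu : ∀ k, AEStronglyMeasurable (u k) m)
    (h : ∀ᵐ x ∂m, Tendsto (fun N => ∑ k ∈ Finset.range N, u k x) atTop (𝓝 (f x))) (n : ℕ) :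
    eLpNorm (fun x => f x - ∑ k ∈ Finset.range n, u k x) p m ≤ ∑' k, eLpNorm (u (k + n)) p m := by
  have hlim : ∀ᵐ x ∂m, Tendsto (fun N => (∑ k ∈ Finset.range N, u (k + n)) x) atTop
      (𝓝 (f x - ∑ k ∈ Finset.range n, u k x)) := by
    filter_upwards [h] with x hx
    refine (((tendsto_add_atTop_iff_nat n).2 hx).sub_const _).congr fun N => ?_
    rw [add_comm N n, Finset.sum_range_add, add_sub_cancel_left, Finset.sum_apply]
    simp_rw [add_comm]
  refine (Lp.eLpNorm_lim_le_liminf_eLpNorm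
    (fun N => Finset.aestronglyMeasurable_sum _ fun k _ => hu (k + n)) _ hlim).trans ?_
  refine liminf_le_of_frequently_le' (Frequently.of_forall fun N => ?_)
  exact (eLpNorm_sum_le (fun k _ => hu (k + n)) hp).trans (ENNReal.sum_le_tsum _)

theorem IsGoodGrid.stronglyMeasurable_condMean (hG : IsGoodGrid m G) (f : I → ℂ) (k : ℕ) :
    StronglyMeasurable[hG.filtration k] (condMean m G f k) :=
  hG.stronglyMeasurable_step k _

theorem IsGoodGrid.stronglyMeasurable_mdiff (hG : IsGoodGrid m G) (f : I → ℂ) (k : ℕ) :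
    StronglyMeasurable[hG.filtration k] (mdiff m G f k) := by
  cases k with
  | zero => exact hG.stronglyMeasurable_condMean f 0
  | succ k =>
    exact (hG.stronglyMeasurable_condMean f (k + 1)).sub
      ((hG.stronglyMeasurable_condMean f k).mono (hG.filtration.mono k.le_succ))

theorem IsGoodGrid.aestronglyMeasurable_mdiff (hG : IsGoodGrid m G) (f : I → ℂ) (k : ℕ) :
    AEStronglyMeasurable (mdiff m G f k) m :=
  ((hG.stronglyMeasurable_mdiff f k).mono (hG.filtration.le k)).aestronglyMeasurable

theorem condMean_add {f g : I → ℂ} (hf : Integrable f m) (hg : Integrable g m) (k : ℕ) :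
    condMean m G (fun x => f x + g x) k
      = fun x => condMean m G f k x + condMean m G g k x := by
  funext x
  unfold condMean
  rw [← Finset.sum_add_distrib]
  refine Finset.sum_congr rfl fun Q _ => ?_
  rw [setAverage_eq, setAverage_eq, setAverage_eq,
    integral_add hf.integrableOn hg.integrableOn, smul_add]
  by_cases hx : x ∈ Q <;> simp [hx]

theorem mdiff_add {f g : I → ℂ} (hf : Integrable f m) (hg : Integrable g m) (k : ℕ) :
    mdiff m G (fun x => f x + g x) k = mdiff m G f k + mdiff m G g k := by
  funext x
  cases k with
  | zero => simp [mdiff, condMean_add hf hg]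
  | succ k =>
    simp only [mdiff, condMean_add hf hg, Pi.add_apply]
    ring

/-- Only finite additivity is used; the remainder stays explicit, to be removed later by `L^p`
convergence. -/
theorem IsGoodGrid.eLpNorm_mdiff_le_add_sum (hG : IsGoodGrid m G) {p : ℝ≥0∞} (hp : 1 ≤ p)
    {f : I → ℂ} {g : ℕ → I → ℂ} (hf : Integrable f m) (hg : ∀ k, Integrable (g k) m) (j n : ℕ) :
    eLpNorm (mdiff m G f j) p m
      ≤ eLpNorm (mdiff m G (fun x => f x - ∑ k ∈ Finset.range n, g k x) j) p m
        + ∑ k ∈ Finset.range n, eLpNorm (mdiff m G (g k) j) p m := by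
  induction n with
  | zero => simp
  | succ n ih =>
    refine ih.trans ?_
    have h1 : Integrable (fun x => f x - ∑ k ∈ Finset.range (n + 1), g k x) m :=
      hf.sub (integrable_finsetSum _ fun k _ => hg k)
    have h2 : (fun x => f x - ∑ k ∈ Finset.range n, g k x)
        = fun x => (f x - ∑ k ∈ Finset.range (n + 1), g k x) + g n x := by
      funext x
      rw [Finset.sum_range_succ]
      ring
    rw [h2, mdiff_add h1 (hg n), Finset.sum_range_succ, add_comm (∑ k ∈ _, _), ← add_assoc]
    gcongr
    exact eLpNorm_add_le (hG.aestronglyMeasurable_mdiff _ j) (hG.aestronglyMeasurable_mdiff _ j) hp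

variable [IsProbabilityMeasure m]

theorem IsGoodGrid.integrable_step (hG : IsGoodGrid m G) (k : ℕ) (a : Set I → ℂ) :
    Integrable (fun x => ∑ Q ∈ G k, Q.indicator (fun _ => a Q) x) m :=
  integrable_finsetSum _ fun Q hQ => (integrable_const _).indicator (hG.measurableSet k Q hQ)

theorem IsGoodGrid.integrable_mdiff (hG : IsGoodGrid m G) (f : I → ℂ) (k : ℕ) :
    Integrable (mdiff m G f k) m := by
  cases k with
  | zero => exact hG.integrable_step 0 _
  | succ k => exact (hG.integrable_step (k + 1) _).sub (hG.integrable_step k _)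

theorem IsGoodGrid.tendsto_condMean (hG : IsGoodGrid m G) {f : I → ℂ} (hf : Integrable f m) :
    ∀ᵐ x ∂m, Tendsto (fun n => condMean m G f n x) atTop (𝓝 (f x)) := by
  -- Lévy's upward theorem for real functions, applied below to the real and imaginary parts.
  have key : ∀ g : I → ℝ, Integrable g m →
      ∀ᵐ x ∂m, Tendsto (fun n => (m[g | hG.filtration n]) x) atTop (𝓝 (g x)) := by
    intro g hg
    have h1 := tendsto_ae_condExp (ℱ := hG.filtration) (μ := m) g
    have h2 : m[g | ⨆ n, hG.filtration n] =ᵐ[m] g := by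
      rw [hG.iSup_filtration]
      exact condExp_of_aestronglyMeasurable' le_rfl hg.aestronglyMeasurable hg
    filter_upwards [h1, h2] with x hx1 hx2
    rwa [hx2] at hx1
  have hre : ∀ᵐ x ∂m, ∀ n, (condMean m G f n x).re
      = (m[fun x => (f x).re | hG.filtration n]) x := ae_all_iff.2 fun n => by
    filter_upwards [hG.condMean_ae_eq_condExp hf n,
      Complex.reCLM.comp_condExp_comm (m := hG.filtration n) hf] with x h1 h2
    rw [h1]
    exact h2
  have him : ∀ᵐ x ∂m, ∀ n, (condMean m G f n x).im
      = (m[fun x => (f x).im | hG.filtration n]) x := ae_all_iff.2 fun n => by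
    filter_upwards [hG.condMean_ae_eq_condExp hf n,
      Complex.imCLM.comp_condExp_comm (m := hG.filtration n) hf] with x h1 h2
    rw [h1]
    exact h2
  filter_upwards [hre, him, key (fun x => (f x).re) hf.re,
    key (fun x => (f x).im) hf.im] with x h1 h2 h3 h4
  have h3' : Tendsto (fun n => (condMean m G f n x).re) atTop (𝓝 (f x).re) := by
    simp only [h1]
    exact h3
  have h4' : Tendsto (fun n => (condMean m G f n x).im) atTop (𝓝 (f x).im) := by
    simp only [h2]
    exact h4
  have := (Complex.continuous_ofReal.tendsto _ |>.comp h3').add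
    ((Complex.continuous_ofReal.tendsto _ |>.comp h4').mul_const Complex.I)
  simpa [Function.comp_def, Complex.re_add_im] using this

theorem IsGoodGrid.eLpNorm_condMean_le (hG : IsGoodGrid m G) {p : ℝ≥0∞} (hp : 1 ≤ p) {f : I → ℂ}
    (hf : Integrable f m) (k : ℕ) : eLpNorm (condMean m G f k) p m ≤ eLpNorm f p m := by
  rw [eLpNorm_congr_ae (hG.condMean_ae_eq_condExp hf k)]
  exact eLpNorm_condExp_le_eLpNorm f hp

theorem IsGoodGrid.eLpNorm_mdiff_le (hG : IsGoodGrid m G) {p : ℝ≥0∞} (hp : 1 ≤ p) {f : I → ℂ}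
    (hf : Integrable f m) (k : ℕ) : eLpNorm (mdiff m G f k) p m ≤ 2 * eLpNorm f p m := by
  rw [two_mul]
  cases k with
  | zero => exact (hG.eLpNorm_condMean_le hp hf 0).trans le_self_add
  | succ k =>
    exact (eLpNorm_sub_le (hG.integrable_step (k + 1) _).aestronglyMeasurable
      (hG.integrable_step k _).aestronglyMeasurable hp).trans
      (add_le_add (hG.eLpNorm_condMean_le hp hf _) (hG.eLpNorm_condMean_le hp hf _))

theorem IsGoodGrid.condMean_ae_eq_self (hG : IsGoodGrid m G) {f : I → ℂ} (hf : Integrable f m)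
    {j k : ℕ} (hjk : j ≤ k) (hm : StronglyMeasurable[hG.filtration j] f) :
    condMean m G f k =ᵐ[m] f := by
  refine (hG.condMean_ae_eq_condExp hf k).trans ?_
  rw [condExp_of_stronglyMeasurable (hG.filtration.le k) (hm.mono (hG.filtration.mono hjk)) hf]

theorem IsGoodGrid.mdiff_ae_eq_zero (hG : IsGoodGrid m G) {f : I → ℂ} (hf : Integrable f m)
    {j k : ℕ} (hjk : j < k) (hm : StronglyMeasurable[hG.filtration j] f) :
    mdiff m G f k =ᵐ[m] 0 := by
  obtain ⟨k, rfl⟩ := Nat.exists_eq_succ_of_ne_zero (Nat.ne_zero_of_lt hjk)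
  filter_upwards [hG.condMean_ae_eq_self hf hjk.le hm,
    hG.condMean_ae_eq_self hf (Nat.le_of_lt_succ hjk) hm] with x h1 h2
  simp only [mdiff, Nat.succ_eq_add_one, Pi.zero_apply] at *
  rw [h1, h2, sub_self]

theorem IsGoodGrid.eLpNorm_sub_sum_mdiff_le (hG : IsGoodGrid m G) {p : ℝ≥0∞} (hp : 1 ≤ p)
    {f : I → ℂ} (hf : Integrable f m) (n : ℕ) :
    eLpNorm (fun x => f x - ∑ k ∈ Finset.range n, mdiff m G f k x) p m
      ≤ ∑' k, eLpNorm (mdiff m G f (k + n)) p m := by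
  refine eLpNorm_sub_sum_le_tsum hp (hG.aestronglyMeasurable_mdiff f) ?_ n
  filter_upwards [hG.tendsto_condMean hf] with x hx
  -- The sum of the first `N + 1` differences is `f_N`, hence the shift by one.
  refine (tendsto_add_atTop_iff_nat 1).1 (hx.congr fun N => ?_)
  exact (sum_mdiff m G f N x).symm

end

/-! ### Cell measures and `L^p` norms of layers. -/

section

variable {I : Type*} [MeasurableSpace I] {m : Measure I} [IsProbabilityMeasure m]
  {P G : ℕ → Finset (Set I)}

theorem real_le_maxMeas {k : ℕ} {Q : Set I} (hQ : Q ∈ G k) : m.real Q ≤ maxMeas m G k := by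
  refine ENNReal.toReal_mono ?_ (Finset.le_sup (f := fun Q => m Q) hQ)
  refine ne_top_of_le_ne_top ENNReal.one_ne_top (Finset.sup_le fun Q _ => prob_le_one)

theorem maxMeas_le_one (k : ℕ) : maxMeas m G k ≤ 1 := by
  refine ENNReal.toReal_le_of_le_ofReal zero_le_one ?_
  rw [ENNReal.ofReal_one]
  exact Finset.sup_le fun Q _ => prob_le_one

theorem minMeas_le_real {k : ℕ} {Q : Set I} (hQ : Q ∈ G k) : minMeas m G k ≤ m.real Q :=
  ENNReal.toReal_mono (measure_ne_top m Q) (Finset.inf_le (f := fun Q => m Q) hQ)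

omit [IsProbabilityMeasure m] in
theorem IsRecalibration.maxMeas_pos (hG : IsRecalibration m P G) (k : ℕ) :
    0 < maxMeas m G k := by
  obtain ⟨δ, _, _, h⟩ := hG.balanced
  refine lt_of_le_of_ne ENNReal.toReal_nonneg fun h0 => ?_
  -- If `ℓ_k` were `0`, the quotient `ℓ_k / m_k` would be `0`, against the lower bound `1`.
  have := (h k).1
  rw [← h0, zero_div] at this
  linarith

theorem IsRecalibration.exists_mul_maxMeas_le (hG : IsRecalibration m P G) :
    ∃ δ : ℝ, 0 < δ ∧ ∀ k, ∀ Q ∈ G k, δ * maxMeas m G k ≤ m.real Q := by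
  obtain ⟨δ, hδ, _, h⟩ := hG.balanced
  refine ⟨δ, hδ, fun k Q hQ => le_trans ?_ (minMeas_le_real hQ)⟩
  have hpos : 0 < minMeas m G k := by
    refine lt_of_le_of_ne ENNReal.toReal_nonneg fun h0 => ?_
    have := (h k).1
    rw [← h0, div_zero] at this
    linarith
  have := (div_le_div_iff₀ hpos hδ).1 (h k).2
  linarith

omit [IsProbabilityMeasure m] in
theorem IsRecalibration.exists_maxMeas_add_le (hG : IsRecalibration m P G) :
    ∃ c : ℝ, 0 < c ∧ c < 1 ∧ ∀ j i, maxMeas m G (j + i) ≤ c ^ i * maxMeas m G j := by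
  obtain ⟨_, c, _, _, hc, hc1, h⟩ := hG.decay
  refine ⟨c, hc, hc1, fun j i => ?_⟩
  induction i with
  | zero => simp
  | succ i ih =>
    have h1 := (div_le_iff₀ (hG.maxMeas_pos (j + i))).1 (h (j + i)).2
    calc maxMeas m G (j + (i + 1)) ≤ c * maxMeas m G (j + i) := h1
      _ ≤ c * (c ^ i * maxMeas m G j) := by gcongr
      _ = c ^ (i + 1) * maxMeas m G j := by ring

omit [IsProbabilityMeasure m] in
theorem layer_eq_step (s p : ℝ) (c : ℕ → Set I → ℂ) (k : ℕ) :
    layer m G s p c k = fun x => ∑ Q ∈ G k,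
      Q.indicator (fun _ => c k Q * ((m.real Q ^ (s - 1 / p) : ℝ) : ℂ)) x := by
  funext x
  refine Finset.sum_congr rfl fun Q _ => ?_
  by_cases hx : x ∈ Q <;> simp [souzaAtom, hx]

theorem IsGoodGrid.real_pos (hG : IsGoodGrid m G) {k : ℕ} {Q : Set I} (hQ : Q ∈ G k) :
    0 < m.real Q :=
  ENNReal.toReal_pos (hG.measure_pos k Q hQ).ne' (measure_ne_top m Q)

theorem IsGoodGrid.integrable_layer (hG : IsGoodGrid m G) (s p : ℝ) (c : ℕ → Set I → ℂ) (k : ℕ) :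
    Integrable (layer m G s p c k) m := by
  rw [layer_eq_step]
  exact hG.integrable_step k _

omit [IsProbabilityMeasure m] in
theorem IsGoodGrid.stronglyMeasurable_layer (hG : IsGoodGrid m G) (s p : ℝ) (c : ℕ → Set I → ℂ)
    (k : ℕ) : StronglyMeasurable[hG.filtration k] (layer m G s p c k) := by
  rw [layer_eq_step]
  exact hG.stronglyMeasurable_step k _

/-- The atom's factor `|Q|^(s - 1/p)` meets `|Q|^(1/p)` from the norm of `1_Q`, leaving `|Q|^s`. -/
theorem IsGoodGrid.eLpNorm_layer (hG : IsGoodGrid m G) {p : ℝ} (hp : 0 < p) (s : ℝ)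
    (c : ℕ → Set I → ℂ) (k : ℕ) :
    eLpNorm (layer m G s p c k) (ENNReal.ofReal p) m
      = (∑ Q ∈ G k, (‖c k Q‖ₑ * ENNReal.ofReal (m.real Q ^ s)) ^ p) ^ (1 / p) := by
  rw [layer_eq_step, hG.eLpNorm_step k hp]
  congr 1
  refine Finset.sum_congr rfl fun Q hQ => ?_
  have hpos := hG.real_pos hQ
  have h1 : m Q = ENNReal.ofReal (m.real Q ^ (1 / p)) ^ p := by
    rw [ENNReal.ofReal_rpow_of_nonneg (by positivity) hp.le, ← Real.rpow_mul hpos.le,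
      one_div_mul_cancel hp.ne', Real.rpow_one, ofReal_measureReal]
  have h2 : ‖((m.real Q ^ (s - 1 / p) : ℝ) : ℂ)‖ₑ = ENNReal.ofReal (m.real Q ^ (s - 1 / p)) := by
    rw [← ofReal_norm, Complex.norm_real, Real.norm_of_nonneg (by positivity)]
  rw [h1, ← ENNReal.mul_rpow_of_nonneg _ _ hp.le, enorm_mul, h2, mul_assoc,
    ← ENNReal.ofReal_mul (by positivity), ← Real.rpow_add hpos, sub_add_cancel]

theorem mul_sum_rpow {ι : Type*} (F : Finset ι) {p : ℝ} (hp : 0 < p) (a : ι → ℝ≥0∞) (t : ℝ≥0∞) :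
    (∑ i ∈ F, (a i * t) ^ p) ^ (1 / p) = t * (∑ i ∈ F, a i ^ p) ^ (1 / p) := by
  simp_rw [ENNReal.mul_rpow_of_nonneg _ _ hp.le]
  rw [← Finset.sum_mul, ENNReal.mul_rpow_of_nonneg _ _ (by positivity), one_div,
    ENNReal.rpow_rpow_inv hp.ne', mul_comm]

theorem IsGoodGrid.eLpNorm_layer_le (hG : IsGoodGrid m G) {p s : ℝ} (hp : 0 < p) (hs : 0 ≤ s)
    (c : ℕ → Set I → ℂ) (k : ℕ) :
    eLpNorm (layer m G s p c k) (ENNReal.ofReal p) m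
      ≤ ENNReal.ofReal (maxMeas m G k ^ s) * (∑ Q ∈ G k, ‖c k Q‖ₑ ^ p) ^ (1 / p) := by
  rw [hG.eLpNorm_layer hp, ← mul_sum_rpow _ hp]
  gcongr with Q hQ
  exact real_le_maxMeas hQ

theorem IsGoodGrid.le_eLpNorm_layer (hG : IsGoodGrid m G) {p s t : ℝ} (hp : 0 < p) (hs : 0 ≤ s)
    (ht : 0 < t) (c : ℕ → Set I → ℂ) {k : ℕ} (h : ∀ Q ∈ G k, t ≤ m.real Q) :
    (∑ Q ∈ G k, ‖c k Q‖ₑ ^ p) ^ (1 / p)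
      ≤ ENNReal.ofReal (t ^ (-s)) * eLpNorm (layer m G s p c k) (ENNReal.ofReal p) m := by
  have h1 : ENNReal.ofReal (t ^ (-s)) * ENNReal.ofReal (t ^ s) = 1 := by
    rw [← ENNReal.ofReal_mul (by positivity), ← Real.rpow_add ht, neg_add_cancel, Real.rpow_zero,
      ENNReal.ofReal_one]
  rw [hG.eLpNorm_layer hp, ← one_mul (_ ^ _), ← h1, mul_assoc, ← mul_sum_rpow _ hp]
  gcongr with Q hQ
  exact h Q hQ

/-! ### The martingale differences as an atomic representation. -/

/-- The coefficients which represent the martingale differences of `f` as layers of atoms. -/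
noncomputable def mdiffCoeff (m : Measure I) (G : ℕ → Finset (Set I)) (s p : ℝ) (f : I → ℂ)
    (k : ℕ) (Q : Set I) : ℂ :=
  ((m.real Q ^ (1 / p - s) : ℝ) : ℂ) * ⨍ y in Q, mdiff m G f k y ∂m

/-- The powers of `|Q|` cancel, so the layer is the cell mean of `d_k f`, which is `d_k f` itself
since it is measurable at level `k`. -/
theorem IsGoodGrid.layer_mdiffCoeff (hG : IsGoodGrid m G) (s p : ℝ) (f : I → ℂ) (k : ℕ) :
    layer m G s p (mdiffCoeff m G s p f) k =ᵐ[m] mdiff m G f k := by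
  refine EventuallyEq.trans (Eq.eventuallyEq ?_) (hG.condMean_ae_eq_self
    (hG.integrable_mdiff f k) le_rfl (hG.stronglyMeasurable_mdiff f k))
  rw [layer_eq_step]
  funext x
  refine Finset.sum_congr rfl fun Q hQ => ?_
  congr 1
  funext _
  have h1 : m.real Q ^ (1 / p - s) * m.real Q ^ (s - 1 / p) = 1 := by
    rw [← Real.rpow_add (hG.real_pos hQ)]
    simp
  rw [mdiffCoeff, mul_right_comm, ← Complex.ofReal_mul, h1, Complex.ofReal_one, one_mul]

theorem IsRecalibration.exists_coeffNorm_mdiffCoeff_le (hG : IsRecalibration m P G) {p s : ℝ}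
    (hp : 0 < p) (hs : 0 ≤ s) {q : ℝ≥0∞} (hq : q ≠ 0) :
    ∃ A : ℝ, 0 < A ∧ ∀ f : I → ℂ,
      coeffNorm G p q (mdiffCoeff m G s p f) ≤ ENNReal.ofReal A * gtNorm m G s p q f := by
  obtain ⟨δ, hδ, h⟩ := hG.exists_mul_maxMeas_le
  -- Every cell of level `k` has measure at least `δ ℓ_k`, and `(δ ℓ_k)^(-s) = δ^(-s) ℓ_k^(-s)`.
  refine ⟨δ ^ (-s), by positivity, fun f => ?_⟩
  rw [gtNorm, ← lqNorm_const_mul hq]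
  refine lqNorm_mono fun k => ?_
  have hpos := hG.maxMeas_pos k
  refine (hG.isGoodGrid.le_eLpNorm_layer hp hs (mul_pos hδ hpos) _ (h k)).trans_eq ?_
  rw [eLpNorm_congr_ae (hG.isGoodGrid.layer_mdiffCoeff s p f k),
    Real.mul_rpow hδ.le hpos.le, ENNReal.ofReal_mul (by positivity), mul_assoc]

/-- One term of an `ℓ^q` norm is at most the norm, so `|d_k f|_p ≤ ℓ_k^s |f|_{GT}`, and `ℓ_k ≤ c^k`
gives a geometric series. -/
theorem IsRecalibration.tsum_eLpNorm_mdiff_lt_top (hG : IsRecalibration m P G) {p s : ℝ}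
    (hs : 0 < s) {q : ℝ≥0∞} (hq : q ≠ 0) {f : I → ℂ} (hf : gtNorm m G s p q f < ∞) :
    ∑' k, eLpNorm (mdiff m G f k) (ENNReal.ofReal p) m < ∞ := by
  obtain ⟨c, hc, hc1, h⟩ := hG.exists_maxMeas_add_le
  have hle : ∀ k, eLpNorm (mdiff m G f k) (ENNReal.ofReal p) m
      ≤ ENNReal.ofReal (c ^ s) ^ k * gtNorm m G s p q f := by
    intro k
    have hpos := hG.maxMeas_pos k
    have h1 : ENNReal.ofReal (maxMeas m G k ^ s) * ENNReal.ofReal (maxMeas m G k ^ (-s)) = 1 := by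
      rw [← ENNReal.ofReal_mul (by positivity), ← Real.rpow_add hpos, add_neg_cancel,
        Real.rpow_zero, ENNReal.ofReal_one]
    have h2 : maxMeas m G k ≤ c ^ k := by
      have := h 0 k
      rw [zero_add] at this
      exact this.trans (mul_le_of_le_one_right (by positivity) (maxMeas_le_one 0))
    rw [← one_mul (eLpNorm _ _ _), ← h1, mul_assoc]
    gcongr
    · rw [← ENNReal.ofReal_pow (by positivity), ← Real.rpow_natCast, ← Real.rpow_mul hc.le,
        mul_comm s, Real.rpow_mul hc.le, Real.rpow_natCast]
      gcongr
    · exact le_lqNorm hq (fun k => ENNReal.ofReal (maxMeas m G k ^ (-s)) *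
        eLpNorm (mdiff m G f k) (ENNReal.ofReal p) m) k
  refine (ENNReal.tsum_le_tsum hle).trans_lt ?_
  rw [ENNReal.tsum_mul_right, ENNReal.tsum_geometric]
  refine ENNReal.mul_lt_top ?_ hf
  rw [ENNReal.inv_lt_top, tsub_pos_iff_lt, ENNReal.ofReal_lt_one]
  exact Real.rpow_lt_one hc.le hc1 hs

theorem IsRecalibration.memLp_of_gtNorm_lt_top (hG : IsRecalibration m P G) {p s : ℝ} (hp : 1 ≤ p)
    (hs : 0 < s) {q : ℝ≥0∞} (hq : q ≠ 0) {f : I → ℂ} (hfi : Integrable f m)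
    (hf : gtNorm m G s p q f < ∞) : MemLp f (ENNReal.ofReal p) m := by
  refine ⟨hfi.aestronglyMeasurable, lt_of_le_of_lt ?_ (hG.tsum_eLpNorm_mdiff_lt_top hs hq hf)⟩
  simpa using hG.isGoodGrid.eLpNorm_sub_sum_mdiff_le (ENNReal.one_le_ofReal.2 hp) hfi 0

theorem IsRecalibration.isRepresentation_mdiffCoeff (hG : IsRecalibration m P G) {p s : ℝ}
    (hp : 1 ≤ p) (hs : 0 < s) {q : ℝ≥0∞} (hq : q ≠ 0) {f : I → ℂ} (hfi : Integrable f m)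
    (hf : gtNorm m G s p q f < ∞) : IsRepresentation m G s p q f (mdiffCoeff m G s p f) := by
  have hsum := hG.tsum_eLpNorm_mdiff_lt_top hs hq hf
  have hae := hG.isGoodGrid.layer_mdiffCoeff s p f
  refine ⟨?_, ?_, ?_⟩
  · simpa only [eLpNorm_congr_ae (hae _)] using hsum
  · refine tendsto_of_tendsto_of_tendsto_of_le_of_le tendsto_const_nhds
      (ENNReal.tendsto_sum_nat_add _ hsum.ne) (fun _ => zero_le) fun n => ?_
    refine le_trans (eLpNorm_congr_ae ?_).le
      (hG.isGoodGrid.eLpNorm_sub_sum_mdiff_le (ENNReal.one_le_ofReal.2 hp) hfi n)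
    filter_upwards [ae_all_iff.2 hae] with x hx
    simp only [hx]
  · obtain ⟨A, _, h⟩ := hG.exists_coeffNorm_mdiffCoeff_le (zero_lt_one.trans_le hp) hs.le hq
    exact (h f).trans_lt (ENNReal.mul_lt_top ENNReal.ofReal_lt_top hf)

/-! ### The Gu-Taibleson norm bounded by any atomic representation. -/

theorem IsGoodGrid.eLpNorm_mdiff_le_tsum (hG : IsGoodGrid m G) {p s : ℝ} (hp : 1 ≤ p)
    {q : ℝ≥0∞} {f : I → ℂ} (hf : Integrable f m) {c : ℕ → Set I → ℂ}
    (hc : IsRepresentation m G s p q f c) (j : ℕ) :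
    eLpNorm (mdiff m G f j) (ENNReal.ofReal p) m
      ≤ ∑' i, 2 * eLpNorm (layer m G s p c (j + i)) (ENNReal.ofReal p) m := by
  have hp' := ENNReal.one_le_ofReal.2 hp
  have hint := hG.integrable_layer s p c
  have hlim := (ENNReal.Tendsto.const_mul (a := 2) hc.tendsto (Or.inr (by simp))).add_const
    (∑' i, 2 * eLpNorm (layer m G s p c (j + i)) (ENNReal.ofReal p) m)
  rw [mul_zero, zero_add] at hlim
  -- With `n + j` layers split off, the first `j` are killed by `d_j` and the other `n` are partial
  -- sums of the series.
  refine ge_of_tendsto ((tendsto_add_atTop_iff_nat j).2 hlim) (Eventually.of_forall fun n => ?_)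
  refine (hG.eLpNorm_mdiff_le_add_sum hp' hf hint j (n + j)).trans (add_le_add ?_ ?_)
  · exact hG.eLpNorm_mdiff_le hp' (hf.sub (integrable_finsetSum _ fun k _ => hint k)) j
  · rw [add_comm n j, Finset.sum_range_add, Finset.sum_eq_zero fun k hk => ?_, zero_add]
    · refine le_trans (Finset.sum_le_sum fun i _ => ?_) (ENNReal.sum_le_tsum (Finset.range n))
      exact hG.eLpNorm_mdiff_le hp' (hint _) j
    · rw [eLpNorm_congr_ae (hG.mdiff_ae_eq_zero (hint k) (Finset.mem_range.1 hk)
        (hG.stronglyMeasurable_layer s p c k)), eLpNorm_zero]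

theorem IsRecalibration.exists_gtNorm_le (hG : IsRecalibration m P G) {p s : ℝ} (hp : 1 ≤ p)
    (hs : 0 < s) {q : ℝ≥0∞} (hq : 1 ≤ q) :
    ∃ B : ℝ, 0 < B ∧ ∀ (f : I → ℂ) (c : ℕ → Set I → ℂ), Integrable f m →
      IsRepresentation m G s p q f c → gtNorm m G s p q f ≤ ENNReal.ofReal B * coeffNorm G p q c := by
  obtain ⟨r, hr, hr1, h⟩ := hG.exists_maxMeas_add_le
  have hp0 := zero_lt_one.trans_le hp
  have hq0 := (zero_lt_one.trans_le hq).ne'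
  have hrs : r ^ s < 1 := Real.rpow_lt_one hr.le hr1 hs
  have hrs' : 0 < 1 - r ^ s := sub_pos.2 hrs
  -- The `2` comes from `|d_j g|_p ≤ 2 |g|_p`, the rest from summing the ratios `(ℓ_{j+i} / ℓ_j)^s ≤
  -- r^(s i)`.
  refine ⟨2 * (1 - r ^ s)⁻¹, by positivity, fun f c hf hc => ?_⟩
  set C : ℕ → ℝ≥0∞ := fun k => (∑ Q ∈ G k, ‖c k Q‖ₑ ^ p) ^ (1 / p) with hC
  have hterm : ∀ j i, ENNReal.ofReal (maxMeas m G j ^ (-s)) *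
      (2 * eLpNorm (layer m G s p c (j + i)) (ENNReal.ofReal p) m)
        ≤ 2 * ENNReal.ofReal (r ^ s) ^ i * C (j + i) := by
    intro j i
    have hj := hG.maxMeas_pos j
    have hji := hG.maxMeas_pos (j + i)
    have h1 : maxMeas m G j ^ (-s) * maxMeas m G (j + i) ^ s ≤ (r ^ s) ^ i := by
      rw [Real.rpow_neg hj.le, ← div_eq_inv_mul, ← Real.div_rpow hji.le hj.le,
        ← Real.rpow_natCast, ← Real.rpow_mul hr.le, mul_comm s, Real.rpow_mul hr.le,
        Real.rpow_natCast]
      gcongr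
      exact (div_le_iff₀ hj).2 (h j i)
    calc ENNReal.ofReal (maxMeas m G j ^ (-s)) *
          (2 * eLpNorm (layer m G s p c (j + i)) (ENNReal.ofReal p) m)
        ≤ ENNReal.ofReal (maxMeas m G j ^ (-s)) *
          (2 * (ENNReal.ofReal (maxMeas m G (j + i) ^ s) * C (j + i))) := by
          gcongr
          exact hG.isGoodGrid.eLpNorm_layer_le hp0 hs.le c (j + i)
      _ = 2 * ENNReal.ofReal (maxMeas m G j ^ (-s) * maxMeas m G (j + i) ^ s) * C (j + i) := by
          rw [ENNReal.ofReal_mul (by positivity)]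
          ring
      _ ≤ _ := by
          rw [← ENNReal.ofReal_pow (by positivity)]
          gcongr
  calc gtNorm m G s p q f
      ≤ lqNorm q fun j => ∑' i, 2 * ENNReal.ofReal (r ^ s) ^ i * C (j + i) := by
        refine lqNorm_mono fun j => ?_
        refine (mul_le_mul_right (hG.isGoodGrid.eLpNorm_mdiff_le_tsum hp hf hc j) _).trans ?_
        rw [← ENNReal.tsum_mul_left]
        exact ENNReal.tsum_le_tsum (hterm j)
    -- Summing over the gap `i` outside leaves, for each `i`, a shift of one fixed sequence; this
    -- treats all `q ∈ [1, ∞]` at once.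
    _ ≤ ∑' i, lqNorm q fun j => 2 * ENNReal.ofReal (r ^ s) ^ i * C (j + i) :=
        lqNorm_tsum_le hq fun i j => 2 * ENNReal.ofReal (r ^ s) ^ i * C (j + i)
    _ ≤ ∑' i, 2 * ENNReal.ofReal (r ^ s) ^ i * lqNorm q C := by
        refine ENNReal.tsum_le_tsum fun i => ?_
        rw [lqNorm_const_mul hq0]
        gcongr
        exact lqNorm_shift_le q C i
    _ = ENNReal.ofReal (2 * (1 - r ^ s)⁻¹) * coeffNorm G p q c := by
        rw [ENNReal.tsum_mul_right, ENNReal.tsum_mul_left, ENNReal.tsum_geometric,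
          ENNReal.ofReal_mul zero_le_two, ENNReal.ofReal_inv_of_pos hrs',
          ENNReal.ofReal_sub _ (by positivity), ENNReal.ofReal_one, ENNReal.ofReal_ofNat,
          coeffNorm]

end

end GridBesov

theorem mainTheorem11 {I : Type*} [TopologicalSpace I] [CompactSpace I] [T2Space I]
    [MeasurableSpace I] [BorelSpace I] (m : Measure I) [IsProbabilityMeasure m]
    (P G : ℕ → Finset (Set I)) (hP : GridBesov.IsGoodGrid m P)
    (hG : GridBesov.IsRecalibration m P G)
    (p s : ℝ) (q : ℝ≥0∞) (hp : 1 ≤ p) (hs : 0 < s) (hsp : s < 1 / p) (hq : 1 ≤ q) :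
    GridBesov.gtBesov m G s p q = GridBesov.souzaBesov m G s p q ∧
    ∃ A B : ℝ, 0 < A ∧ 0 < B ∧ ∀ f ∈ GridBesov.souzaBesov m G s p q,
      GridBesov.souzaNorm m G s p q f ≤ ENNReal.ofReal A * GridBesov.gtNorm m G s p q f ∧
      GridBesov.gtNorm m G s p q f ≤ ENNReal.ofReal B * GridBesov.souzaNorm m G s p q f := by
  have hq0 := (zero_lt_one.trans_le hq).ne'
  obtain ⟨A, hA, hAle⟩ := hG.exists_coeffNorm_mdiffCoeff_le (zero_lt_one.trans_le hp) hs.le hq0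
  obtain ⟨B, hB, hBle⟩ := hG.exists_gtNorm_le hp hs hq
  have hsub : ∀ f ∈ GridBesov.souzaBesov m G s p q, f ∈ GridBesov.gtBesov m G s p q := by
    rintro f ⟨hf, c, hc⟩
    have hfi := hf.integrable (ENNReal.one_le_ofReal.2 hp)
    exact ⟨hfi, (hBle f c hfi hc).trans_lt
      (ENNReal.mul_lt_top ENNReal.ofReal_lt_top hc.coeffNorm_lt_top)⟩
  refine ⟨Set.Subset.antisymm ?_ hsub, A, B, hA, hB, fun f hf => ⟨?_, ?_⟩⟩
  · rintro f ⟨hfi, hf⟩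
    exact ⟨hG.memLp_of_gtNorm_lt_top hp hs hq0 hfi hf, _,
      hG.isRepresentation_mdiffCoeff hp hs hq0 hfi hf⟩
  · obtain ⟨hfi, hfn⟩ := hsub f hf
    exact (iInf₂_le _ (hG.isRepresentation_mdiffCoeff hp hs hq0 hfi hfn)).trans (hAle f)
  · unfold GridBesov.souzaNorm
    -- `B` does not depend on the representation, so the bound passes to the infimum.
    simp_rw [ENNReal.mul_iInf_of_ne (ENNReal.ofReal_pos.2 hB).ne' ENNReal.ofReal_ne_top]
    exact le_iInf₂ fun c hc => hBle f c (hsub f hf).1 hc
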